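/- For $\psi>0$ and $\xi\in\mathbb R$ let $G_{\xi,\psi}$ be the distribution function of the generalized Pareto distribution: $G_{\xi,\psi}(x)=0$ for $x\le 0$ and, for $x>0$, $G_{\xi,\psi}(x)=1-\max(0,1+\xi x/\psi)^{-1/\xi}$ if $\xi\ne0$, $G_{0,\psi}(x)=1-e^{-x/\psi}$. For a real random variable $X$ with distribution function $F$ let $x_+=\sup\{x: F(x)<1\}\in(-\infty,\infty]$ and, for $t<x_+$, let $F_t(x)=P(X-t\le x\mid X>t)$ be the distribution function of the residual distribution of $X$ over $t$. Say that the limiting behaviour of the residual distribution of $X$ is GPD with shape $\xi$ if there is a positive function $\psi(t)$ such that $\lim_{t\uparrow x_+}\sup_{x\in\mathbb R}|F_t(x)-G_{\xi,\psi(t)}(x)|=0$. Let $X$ be a real random variable such that the limiting behaviour of its residual distribution is GPD with shape $\xi$. (1) If $\xi\ge 0$ and $X>0$ almost surely, then the limiting behaviour of the residual distribution of $X^*=-1/X$ is GPD with shape $-\xi$. (2) If $\xi<0$, then $x_+<\infty$ and the limiting behaviour of the residual distribution of $X^*=-1/(X-x_+)$ is GPD with shape $-\xi$; in particular, if $x_+=0$,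 this holds for $X^*=-1/X$. -/

import Mathlib

open MeasureTheory ProbabilityTheory Filter Topology Set

noncomputable section

/-- Distribution function of the generalized Pareto distribution with shape `ξ` and scale `ψ > 0`:
`1 - (1 + ξ x / ψ)^(-1/ξ)` on its support, the exponential distribution function for `ξ = 0`.
For `ξ < 0` and `x ≥ ψ / |ξ|` the truncation at `0` makes the value equal to `1`. -/
def gpdCDF (ξ ψ x : ℝ) : ℝ :=
  if x ≤ 0 then 0
  else if ξ = 0 then 1 - Real.exp (-x / ψ)
  else 1 - (max 0 (1 + ξ * x / ψ)) ^ (-1 / ξ)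

/-- The right endpoint `x₊ = sup {x : F x < 1}` of the distribution function `F` of `X`,
possibly `+∞`. -/
def rightEndpoint {Ω : Type*} [MeasurableSpace Ω] (P : Measure Ω) (X : Ω → ℝ) : EReal :=
  sSup ((fun x : ℝ => (x : EReal)) '' {x : ℝ | cdf (P.map X) x < 1})

/-- The residual distribution of `X` over `t`: the law of `X - t` conditionally on `X > t`. -/
def residualLaw {Ω : Type*} [MeasurableSpace Ω] (P : Measure Ω) (X : Ω → ℝ) (t : ℝ) : Measure ℝ :=
  (P[|{ω | t < X ω}]).map (fun ω => X ω - t)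

/-- Real thresholds `t` tending to the right endpoint of `X` from below. -/
def highThresholds {Ω : Type*} [MeasurableSpace Ω] (P : Measure Ω) (X : Ω → ℝ) : Filter ℝ :=
  comap (fun t : ℝ => (t : EReal)) (𝓝[<] rightEndpoint P X)

/-- The limiting behaviour of the residual distribution of `X` over high thresholds is GPD with
shape `ξ`: for some positive scale function `ψ`, the distribution function of the residual
distribution over `t` and that of `GPD(ξ, ψ t)` become uniformly close as `t` tends to the
right endpoint. -/
def ResidualLimitGPD {Ω : Type*} [MeasurableSpace Ω] (P : Measure Ω) (X : Ω → ℝ) (ξ : ℝ) : Prop :=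
  ∃ ψ : ℝ → ℝ, (∀ t, 0 < ψ t) ∧
    TendstoUniformly (fun t x => cdf (residualLaw P X t) x - gpdCDF ξ (ψ t) x) (fun _ => 0)
      (highThresholds P X)

end

/-! Write S for the survival function of X and K_ξ for `gpdSurvival ξ`. The hypothesis says that
S(t+xψ(t))/S(t) approaches K_ξ(x) uniformly in x ≥ 0. A reciprocal turns a scaled exceedance w into
w/(1-ξw), and K_ξ(w/(1-ξw)) = K_{-ξ}(w) (`gpdSurvival_div_one_sub`), so the shape changes sign
exactly, provided the scale is ξt for ξ > 0 or -ξ(x_+ - t) for ξ < 0. The real content is that ψ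
must be asymptotic to this scale. For ξ = 0 it suffices that τ = ψ(t)/t tends to 0: then w/(1-τw) is
a negligible perturbation of w.

The asymptotics of ψ come from reaching a point beyond t' = t+xψ(t) in two ways, directly from t and
through t'. As K_ξ is stable under residuals (`gpdSurvival_add`) and strictly decreasing on [0,∞)
while positive, ψ(t') ≈ (1+ξx)ψ(t) (`IsGPDTail.eventually_scale_step`). Iterating t ↦ t+cψ(t), along
which S decays geometrically, gives ψ(t)-ξt = o(t) if ξ ≥ 0 and the endpoint is infinite, and shows
x_+ - t ~ ψ(t)/(-ξ) if ξ < 0. A finite endpoint with ξ = 0 forces ψ(t) = o(x_+ - t), because K_0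
never vanishes. -/

/-! ### The unit-scale Pareto tail -/

/-- Survival function of the generalized Pareto distribution with shape `ξ` and unit scale. -/
noncomputable def gpdSurvival (ξ x : ℝ) : ℝ :=
  if ξ = 0 then Real.exp (-max x 0) else (max 0 (1 + ξ * max x 0)) ^ (-1 / ξ)

theorem gpdCDF_eq_one_sub_gpdSurvival {ψ : ℝ} (hψ : 0 < ψ) (ξ x : ℝ) :
    gpdCDF ξ ψ x = 1 - gpdSurvival ξ (x / ψ) := by
  unfold gpdCDF gpdSurvival
  rcases le_or_gt x 0 with hx | hx
  · have : max (x / ψ) 0 = 0 := max_eq_right (div_nonpos_of_nonpos_of_nonneg hx hψ.le)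
    simp [hx, this]
  · have : max (x / ψ) 0 = x / ψ := max_eq_left (by positivity)
    simp only [this, not_le.2 hx, if_false]
    split_ifs
    · rw [neg_div]
    · rw [mul_div_assoc]

theorem gpdSurvival_zero_shape {x : ℝ} (hx : 0 ≤ x) : gpdSurvival 0 x = Real.exp (-x) := by
  simp [gpdSurvival, hx]

theorem gpdSurvival_of_ne {ξ x : ℝ} (hξ : ξ ≠ 0) (hx : 0 ≤ x) :
    gpdSurvival ξ x = (max 0 (1 + ξ * x)) ^ (-1 / ξ) := by
  simp [gpdSurvival, hξ, hx]

theorem gpdSurvival_of_nonpos {ξ x : ℝ} (hx : x ≤ 0) : gpdSurvival ξ x = 1 := by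
  simp [gpdSurvival, hx]

theorem gpdSurvival_nonneg (ξ x : ℝ) : 0 ≤ gpdSurvival ξ x := by
  unfold gpdSurvival
  split_ifs
  · exact (Real.exp_pos _).le
  · exact Real.rpow_nonneg (le_max_left _ _) _

theorem gpdSurvival_pos {ξ x : ℝ} (h : 0 < 1 + ξ * x) : 0 < gpdSurvival ξ x := by
  rcases le_or_gt x 0 with hx | hx
  · simp [gpdSurvival_of_nonpos hx]
  by_cases hξ : ξ = 0
  · subst hξ; rw [gpdSurvival_zero_shape hx.le]; exact Real.exp_pos _
  · rw [gpdSurvival_of_ne hξ hx.le, max_eq_right h.le]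
    exact Real.rpow_pos_of_pos h _

theorem gpdSurvival_lt_of_lt {ξ x y : ℝ} (hy0 : 0 < y) (hxy : x < y) (hy : 0 < 1 + ξ * y) :
    gpdSurvival ξ y < gpdSurvival ξ x := by
  wlog hx : 0 ≤ x generalizing x
  · rw [gpdSurvival_of_nonpos (not_le.1 hx).le, ← gpdSurvival_of_nonpos (ξ := ξ) le_rfl]
    exact this hy0 le_rfl
  rcases lt_trichotomy ξ 0 with hξ | hξ | hξ
  · rw [gpdSurvival_of_ne hξ.ne hx, gpdSurvival_of_ne hξ.ne hy0.le, max_eq_right hy.le]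
    have : 1 + ξ * y < 1 + ξ * x := by nlinarith
    rw [max_eq_right (by linarith)]
    exact Real.rpow_lt_rpow hy.le this (div_pos_of_neg_of_neg (by norm_num) hξ)
  · subst hξ
    rw [gpdSurvival_zero_shape hx, gpdSurvival_zero_shape hy0.le]
    exact Real.exp_lt_exp.2 (by linarith)
  · rw [gpdSurvival_of_ne hξ.ne' hx, gpdSurvival_of_ne hξ.ne' hy0.le, max_eq_right hy.le]
    have : 1 + ξ * x < 1 + ξ * y := by nlinarith
    have h1 : 0 < 1 + ξ * x := by positivity
    rw [max_eq_right h1.le]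
    exact Real.rpow_lt_rpow_of_neg h1 this (div_neg_of_neg_of_pos (by norm_num) hξ)

theorem gpdSurvival_eq_zero {ξ x : ℝ} (h : 1 + ξ * x ≤ 0) (hx : 0 ≤ x) : gpdSurvival ξ x = 0 := by
  have hξ : ξ < 0 := by
    by_contra! hc
    nlinarith [mul_nonneg hc hx]
  rw [gpdSurvival_of_ne hξ.ne hx, max_eq_left h]
  exact Real.zero_rpow (div_ne_zero (by norm_num) hξ.ne)

theorem antitone_gpdSurvival (ξ : ℝ) : Antitone (gpdSurvival ξ) := by
  intro x y hxy
  rcases hxy.eq_or_lt with rfl | hlt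
  · rfl
  rcases le_or_gt y 0 with hy | hy
  · rw [gpdSurvival_of_nonpos hy, gpdSurvival_of_nonpos (hxy.trans hy)]
  rcases le_or_gt (1 + ξ * y) 0 with h | h
  · rw [gpdSurvival_eq_zero h hy.le]; exact gpdSurvival_nonneg _ _
  · exact (gpdSurvival_lt_of_lt hy hlt h).le

theorem gpdSurvival_le_one (ξ x : ℝ) : gpdSurvival ξ x ≤ 1 := by
  rcases le_or_gt x 0 with hx | hx
  · rw [gpdSurvival_of_nonpos hx]
  · exact (antitone_gpdSurvival ξ hx.le).trans (gpdSurvival_of_nonpos le_rfl).le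

theorem continuous_gpdSurvival (ξ : ℝ) : Continuous (gpdSurvival ξ) := by
  by_cases hξ : ξ = 0
  · have : gpdSurvival ξ = fun x => Real.exp (-max x 0) := by ext x; simp [gpdSurvival, hξ]
    rw [this]; fun_prop
  · have : gpdSurvival ξ = fun x => (max 0 (1 + ξ * max x 0)) ^ (-1 / ξ) := by
      ext x; simp [gpdSurvival, hξ]
    rw [this]
    refine Continuous.rpow_const (by fun_prop) fun x => ?_
    rcases lt_or_gt_of_ne hξ with h | h
    · right; exact (div_pos_of_neg_of_neg (by norm_num) h).le
    · left
      have : 0 < 1 + ξ * max x 0 := by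
        have := mul_nonneg h.le (le_max_right x 0)
        linarith
      exact (lt_max_of_lt_right this).ne'

theorem tendsto_gpdSurvival_atTop (ξ : ℝ) : Tendsto (gpdSurvival ξ) atTop (𝓝 0) := by
  rcases lt_trichotomy ξ 0 with hξ | hξ | hξ
  · refine tendsto_const_nhds.congr' ?_
    filter_upwards [eventually_ge_atTop (-1 / ξ), eventually_ge_atTop 0] with x hx hx0
    rw [gpdSurvival_eq_zero _ hx0]
    rw [div_le_iff_of_neg hξ] at hx
    linarith
  · subst hξ
    refine (Real.tendsto_exp_neg_atTop_nhds_zero).congr' ?_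
    filter_upwards [eventually_ge_atTop 0] with x hx
    rw [gpdSurvival_zero_shape hx]
  · have h1 : Tendsto (fun x : ℝ => 1 + ξ * x) atTop atTop :=
      tendsto_atTop_add_const_left _ _ (tendsto_id.const_mul_atTop hξ)
    have h2 := (tendsto_rpow_neg_atTop (one_div_pos.2 hξ)).comp h1
    refine h2.congr' ?_
    filter_upwards [eventually_ge_atTop 0] with x hx
    rw [gpdSurvival_of_ne hξ.ne' hx, max_eq_right (by positivity), neg_div]
    rfl

/-- Threshold stability: 1+ξ(x+(1+ξx)z) = (1+ξx)(1+ξz), so the residual over x has the same shape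
and scale 1+ξx. -/
theorem gpdSurvival_add {ξ x z : ℝ} (hx : 0 ≤ x) (hz : 0 ≤ z) (h : 0 < 1 + ξ * x) :
    gpdSurvival ξ (x + (1 + ξ * x) * z) = gpdSurvival ξ x * gpdSurvival ξ z := by
  have h0 : 0 ≤ x + (1 + ξ * x) * z := by positivity
  by_cases hξ : ξ = 0
  · subst hξ
    rw [gpdSurvival_zero_shape hx, gpdSurvival_zero_shape hz, gpdSurvival_zero_shape h0,
      ← Real.exp_add]
    ring_nf
  · rw [gpdSurvival_of_ne hξ hx, gpdSurvival_of_ne hξ hz, gpdSurvival_of_ne hξ h0,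
      ← Real.mul_rpow (le_max_left _ _) (le_max_left _ _), max_eq_right h.le,
      mul_max_of_nonneg _ _ h.le, mul_zero]
    ring_nf

theorem gpdSurvival_div_one_sub {ξ w : ℝ} (hξ : ξ ≠ 0) (hw : 0 ≤ w) (h : 0 < 1 - ξ * w) :
    gpdSurvival ξ (w / (1 - ξ * w)) = gpdSurvival (-ξ) w := by
  rw [gpdSurvival_of_ne hξ (by positivity), gpdSurvival_of_ne (neg_ne_zero.2 hξ) hw]
  have : 1 + ξ * (w / (1 - ξ * w)) = (1 - ξ * w)⁻¹ := by field_simp; ring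
  rw [this, max_eq_right (by positivity), max_eq_right (by linarith), Real.inv_rpow h.le,
    ← Real.rpow_neg h.le]
  congr 1
  · ring
  · rw [div_neg]

/-- The unit-scale survival function is stable under small changes of scale, uniformly. -/
theorem exists_forall_abs_gpdSurvival_mul_sub_le (ξ : ℝ) {ε : ℝ} (hε : 0 < ε) :
    ∃ η > 0, ∀ r, |r - 1| ≤ η → ∀ x, 0 ≤ x →
      |gpdSurvival ξ (r * x) - gpdSurvival ξ x| ≤ ε := by
  obtain ⟨M, hM⟩ := eventually_atTop.1
    (((tendsto_gpdSurvival_atTop ξ).eventually (gt_mem_nhds hε)).and (eventually_gt_atTop 0))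
  have hM0 : 0 < M := (hM M le_rfl).2
  have huc := isCompact_Icc (a := 0) (b := 3 * M) |>.uniformContinuousOn_of_continuous
    (continuous_gpdSurvival ξ).continuousOn
  obtain ⟨δ, hδ, hd⟩ := Metric.uniformContinuousOn_iff.1 huc ε hε
  -- For x ≤ 2M both arguments lie in [0,3M] at distance at most δ/2; for x > 2M both exceed M,
  -- where the tail is below ε.
  refine ⟨min (1 / 2) (δ / (4 * M)), by positivity, fun r hr x hx => ?_⟩
  have hr1 : |r - 1| ≤ 1 / 2 := hr.trans (min_le_left _ _)
  have hr2 : |r - 1| ≤ δ / (4 * M) := hr.trans (min_le_right _ _)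
  have hr3 := abs_le.1 hr1
  rcases le_or_gt x (2 * M) with hxM | hxM
  · have hdist : dist (r * x) x < δ := by
      rw [Real.dist_eq, show r * x - x = (r - 1) * x by ring, abs_mul, abs_of_nonneg hx]
      calc |r - 1| * x ≤ δ / (4 * M) * (2 * M) := by gcongr
        _ = δ / 2 := by field_simp; ring
        _ < δ := by linarith
    have := hd (r * x) ⟨by nlinarith, by nlinarith⟩ x ⟨hx, by linarith⟩ hdist
    rw [Real.dist_eq] at this
    exact this.le
  · have h1 := (hM (r * x) (by nlinarith)).1
    have h2 := (hM x (by linarith)).1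
    have h3 := gpdSurvival_nonneg ξ (r * x)
    have h4 := gpdSurvival_nonneg ξ x
    rw [abs_le]; constructor <;> linarith

/-! ### Survival functions and the limit condition as an inequality -/

/-- The survival function `t ↦ P(X > t)`. -/
noncomputable def survival {Ω : Type*} [MeasurableSpace Ω] (P : Measure Ω) (X : Ω → ℝ) (t : ℝ) : ℝ :=
  P.real {ω | t < X ω}

/-- `p t` holds for all thresholds `t` close enough to the right endpoint of the survival
function `S`. -/
def EventuallyTail (S : ℝ → ℝ) (p : ℝ → Prop) : Prop :=
  ∃ T, 0 < S T ∧ ∀ t, T ≤ t → 0 < S t → p t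

/-- The conditional tails `S (t + x) / S t` become uniformly close to those of `GPD(ξ, ψ t)`. -/
def IsGPDTail (S : ℝ → ℝ) (ξ : ℝ) (ψ : ℝ → ℝ) : Prop :=
  ∀ ε > 0, EventuallyTail S fun t => ∀ x, 0 ≤ x →
    |S (t + x) - gpdSurvival ξ (x / ψ t) * S t| ≤ ε * S t

theorem EventuallyTail.and {S : ℝ → ℝ} {p q : ℝ → Prop} (hp : EventuallyTail S p)
    (hq : EventuallyTail S q) : EventuallyTail S fun t => p t ∧ q t := by
  obtain ⟨T, hT, h⟩ := hp
  obtain ⟨T', hT', h'⟩ := hq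
  refine ⟨max T T', ?_, fun t ht hS => ⟨h t ((le_max_left _ _).trans ht) hS,
    h' t ((le_max_right _ _).trans ht) hS⟩⟩
  rcases max_choice T T' with hm | hm <;> rw [hm] <;> assumption

theorem EventuallyTail.mono {S : ℝ → ℝ} {p q : ℝ → Prop} (hp : EventuallyTail S p)
    (h : ∀ t, 0 < S t → p t → q t) : EventuallyTail S q := by
  obtain ⟨T, hT, hp⟩ := hp
  exact ⟨T, hT, fun t ht hS => h t hS (hp t ht hS)⟩

theorem eventuallyTail_ge {S : ℝ → ℝ} {T : ℝ} (hT : 0 < S T) : EventuallyTail S fun t => T ≤ t :=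
  ⟨T, hT, fun _ h _ => h⟩

section Survival

variable {Ω : Type*} [MeasurableSpace Ω] (P : Measure Ω) (X : Ω → ℝ)

theorem survival_nonneg (t : ℝ) : 0 ≤ survival P X t := measureReal_nonneg

variable [IsProbabilityMeasure P]

theorem antitone_survival : Antitone (survival P X) := fun _ _ h =>
  measureReal_mono fun _ hω => lt_of_le_of_lt h hω

variable {X}

/-- Right continuity of the survival function: {X > t} is the union of the events {X > t+1/(n+1)}.
-/
theorem exists_gt_survival_pos {t : ℝ} (ht : 0 < survival P X t) :
    ∃ x, t < x ∧ 0 < survival P X x := by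
  have hU : {ω | t < X ω} = ⋃ n : ℕ, {ω | t + 1 / ((n : ℝ) + 1) < X ω} := by
    ext ω
    simp only [mem_ofPred_eq, mem_iUnion]
    constructor
    · intro h
      obtain ⟨n, hn⟩ := exists_nat_one_div_lt (sub_pos.2 h)
      exact ⟨n, by linarith⟩
    · rintro ⟨n, hn⟩
      have : (0 : ℝ) < 1 / ((n : ℝ) + 1) := by positivity
      linarith
  by_contra! hc
  have h0 : P {ω | t < X ω} = 0 := by
    rw [hU, measure_iUnion_null_iff]
    intro n
    have h1 := hc (t + 1 / ((n : ℝ) + 1)) (by have : (0 : ℝ) < 1 / ((n : ℝ) + 1) := by positivity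
                                              linarith)
    have h2 := le_antisymm h1 (survival_nonneg P X _)
    exact (measureReal_eq_zero_iff (measure_ne_top _ _)).1 h2
  rw [survival, measureReal_def, h0] at ht
  simp at ht

theorem cdf_map_eq_one_sub_survival (hX : Measurable X) (x : ℝ) :
    cdf (P.map X) x = 1 - survival P X x := by
  have := Measure.isProbabilityMeasure_map (μ := P) hX.aemeasurable
  rw [cdf_eq_real, map_measureReal_apply hX measurableSet_Iic, survival]
  have h := probReal_compl_eq_one_sub (μ := P) (measurableSet_lt (measurable_const (a := x)) hX)
  rw [← h]
  congr 1
  ext ω; simp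

theorem lt_rightEndpoint_iff (hX : Measurable X) (t : ℝ) :
    (t : EReal) < rightEndpoint P X ↔ 0 < survival P X t := by
  simp only [rightEndpoint, lt_sSup_iff, mem_image, mem_ofPred_eq, exists_exists_and_eq_and,
    cdf_map_eq_one_sub_survival P hX, EReal.coe_lt_coe_iff]
  constructor
  · rintro ⟨x, hx, htx⟩
    have := antitone_survival P X htx.le
    linarith
  · intro h
    obtain ⟨x, hx, hS⟩ := exists_gt_survival_pos P h
    exact ⟨x, by linarith, hx⟩

theorem exists_survival_pos (hX : Measurable X) : ∃ t, 0 < survival P X t := by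
  obtain ⟨t, ht⟩ := ((tendsto_cdf_atBot (P.map X)).eventually
    (gt_mem_nhds (zero_lt_one' ℝ))).exists
  rw [cdf_map_eq_one_sub_survival P hX] at ht
  exact ⟨t, by linarith⟩

/-- The survival function is positive exactly below the right endpoint, so finite and infinite
endpoints are treated alike. -/
theorem eventually_highThresholds_iff (hX : Measurable X) {p : ℝ → Prop} :
    (∀ᶠ t in highThresholds P X, p t) ↔ EventuallyTail (survival P X) p := by
  obtain ⟨t₀, ht₀⟩ := exists_survival_pos P hX
  rw [highThresholds, eventually_comap,
    (nhdsLT_basis_of_exists_lt ⟨_, (lt_rightEndpoint_iff P hX t₀).2 ht₀⟩).eventually_iff]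
  constructor
  · rintro ⟨i, hi, h⟩
    obtain ⟨T, hiT, hT⟩ := EReal.lt_iff_exists_real_btwn.1 hi
    refine ⟨T, (lt_rightEndpoint_iff P hX T).1 hT, fun t htT hS => h ⟨?_, ?_⟩ t rfl⟩
    · exact hiT.trans_le (EReal.coe_le_coe_iff.2 htT)
    · exact (lt_rightEndpoint_iff P hX t).2 hS
  · rintro ⟨T, hT, h⟩
    refine ⟨T, (lt_rightEndpoint_iff P hX T).2 hT, ?_⟩
    rintro _ ⟨h1, h2⟩ t rfl
    exact h t (EReal.coe_le_coe_iff.1 h1.le) ((lt_rightEndpoint_iff P hX t).1 h2)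

theorem cdf_residualLaw (hX : Measurable X) {t : ℝ} (ht : 0 < survival P X t) (x : ℝ) :
    cdf (residualLaw P X t) x = 1 - survival P X (t + max x 0) / survival P X t := by
  have hA : MeasurableSet {ω | t < X ω} := measurableSet_lt measurable_const hX
  have hP : P {ω | t < X ω} ≠ 0 := by
    intro h0
    rw [survival, measureReal_def, h0] at ht
    simp at ht
  have := cond_isProbabilityMeasure hP
  have hm : Measurable fun ω => X ω - t := hX.sub_const t
  have : IsProbabilityMeasure (residualLaw P X t) :=
    Measure.isProbabilityMeasure_map hm.aemeasurable
  rw [cdf_eq_real, residualLaw, map_measureReal_apply hm measurableSet_Iic]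
  have hB : MeasurableSet {ω | t + x < X ω} := measurableSet_lt measurable_const hX
  have hc : (fun ω => X ω - t) ⁻¹' Iic x = {ω | t + x < X ω}ᶜ := by
    ext ω; simp [add_comm]
  rw [hc, probReal_compl_eq_one_sub hB, measureReal_def, cond_apply hA, ENNReal.toReal_mul,
    ENNReal.toReal_inv, survival, survival, div_eq_inv_mul]
  have hi : {ω | t < X ω} ∩ {ω | t + x < X ω} = {ω | t + max x 0 < X ω} := by
    ext ω
    simp only [mem_inter_iff, mem_ofPred_eq]
    rcases max_cases x 0 with ⟨h1, h2⟩ | ⟨h1, h2⟩ <;> rw [h1] <;> constructor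
    · exact fun h => h.2
    · exact fun h => ⟨by linarith, h⟩
    · exact fun h => by linarith [h.1]
    · exact fun h => ⟨by linarith, by linarith⟩
  rw [hi]
  rfl

/-- Multiplying by P(X > t) clears the conditioning; negative x contribute nothing, since both
distribution functions vanish there. -/
theorem residualLimitGPD_iff (hX : Measurable X) (ξ : ℝ) :
    ResidualLimitGPD P X ξ ↔ ∃ ψ : ℝ → ℝ, (∀ t, 0 < ψ t) ∧ IsGPDTail (survival P X) ξ ψ := by
  have key : ∀ (ψ : ℝ → ℝ), (∀ t, 0 < ψ t) → ∀ t, 0 < survival P X t → ∀ x,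
      |cdf (residualLaw P X t) x - gpdCDF ξ (ψ t) x| * survival P X t =
        |survival P X (t + max x 0) - gpdSurvival ξ (max x 0 / ψ t) * survival P X t| := by
    intro ψ hψ t ht x
    have hK : gpdSurvival ξ (x / ψ t) = gpdSurvival ξ (max x 0 / ψ t) := by
      rcases max_cases x 0 with ⟨h1, h2⟩ | ⟨h1, h2⟩ <;> rw [h1]
      rw [gpdSurvival_of_nonpos (div_nonpos_of_nonpos_of_nonneg h2.le (hψ t).le),
        gpdSurvival_of_nonpos (by simp)]
    rw [cdf_residualLaw P hX ht, gpdCDF_eq_one_sub_gpdSurvival (hψ t), hK, ← abs_neg]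
    nth_rewrite 2 [← abs_of_pos ht]
    rw [← abs_mul]
    congr 1
    field_simp
    ring
  refine exists_congr fun ψ => and_congr_right fun hψ => ?_
  rw [Metric.tendstoUniformly_iff]
  simp only [eventually_highThresholds_iff P hX, IsGPDTail, dist_zero_left, Real.norm_eq_abs]
  constructor
  · intro h ε hε
    refine (h ε hε).mono fun t ht hp x hx => ?_
    have := key ψ hψ t ht x
    rw [max_eq_left hx] at this
    rw [← this]
    exact mul_le_mul_of_nonneg_right (hp x).le ht.le
  · intro h ε hε
    refine (h (ε / 2) (half_pos hε)).mono fun t ht hp x => ?_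
    have h1 := hp (max x 0) (le_max_right _ _)
    rw [← key ψ hψ t ht x] at h1
    exact (le_of_mul_le_mul_right h1 ht).trans_lt (half_lt_self hε)

theorem rightEndpoint_eq_coe (hX : Measurable X) {a : ℝ} (ha : survival P X a = 0)
    (h : ∀ t < a, 0 < survival P X t) : rightEndpoint P X = a := by
  refine le_antisymm (not_lt.1 fun hc => ?_) (not_lt.1 fun hc => ?_)
  · exact ((lt_rightEndpoint_iff P hX a).1 hc).ne' ha
  · obtain ⟨r, hr, hra⟩ := EReal.lt_iff_exists_real_btwn.1 hc
    exact lt_asymm hr ((lt_rightEndpoint_iff P hX r).2 (h r (EReal.coe_lt_coe_iff.1 hra)))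

end Survival

/-! ### Asymptotics of the scale function -/

section Tail

variable {S ψ : ℝ → ℝ} {ξ : ℝ}

/-- The scale function of a GPD tail is asymptotically affine along its own steps. -/
theorem IsGPDTail.eventually_scale_step (h : IsGPDTail S ξ ψ) (hS : Antitone S)
    (hψ : ∀ t, 0 < ψ t) {c : ℝ} (hc : 0 < c) (hξc : 0 < 1 + ξ * c) {ε : ℝ} (hε : 0 < ε) :
    EventuallyTail S fun t => ∀ x, 0 ≤ x → x ≤ c →
      0 < S (t + x * ψ t) ∧ |ψ (t + x * ψ t) - (1 + ξ * x) * ψ t| ≤ ε * ψ t := by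
  set B := 1 + |ξ| * c with hB
  have hB0 : 0 < B := by positivity
  set e := min (ε / B) (1 / 2) with he
  have he0 : 0 < e := by positivity
  have he1 : e ≤ ε / B := min_le_left _ _
  set k := gpdSurvival ξ c with hk
  have hk0 : 0 < k := gpdSurvival_pos hξc
  have hm1 : k < gpdSurvival ξ (c * (1 - e)) := gpdSurvival_lt_of_lt hc (by nlinarith) hξc
  have hm2 : gpdSurvival ξ (c * (1 + e)) < k := by
    have hlt : c < c * (1 + e) := by nlinarith
    rcases le_or_gt (1 + ξ * (c * (1 + e))) 0 with h0 | h0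
    · rw [gpdSurvival_eq_zero h0 (by positivity)]; exact hk0
    · exact gpdSurvival_lt_of_lt (by positivity) hlt h0
  set m := min (gpdSurvival ξ (c * (1 - e)) - k) (k - gpdSurvival ξ (c * (1 + e))) with hm
  have hm0 : 0 < m := lt_min (by linarith) (by linarith)
  -- The bound k/2 keeps S positive at t+xψ(t); the bound mk/4 makes the total error 3δ less than
  -- mk.
  set δ := min (k / 2) (m * k / 4) with hδ
  have hδ0 : 0 < δ := by positivity
  refine EventuallyTail.mono (p := fun t => 0 < S t ∧ ∀ x, 0 ≤ x → x ≤ c →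
      0 < S (t + x * ψ t) ∧ |S (t + x * ψ t + c * ψ (t + x * ψ t)) - k * S (t + x * ψ t)|
        ≤ δ * S (t + x * ψ t) ∧ (∀ y, 0 ≤ y →
      |S (t + y) - gpdSurvival ξ (y / ψ t) * S t| ≤ δ * S t)) ?_ ?_
  · obtain ⟨T, hT, hp⟩ := h δ hδ0
    refine ⟨T, hT, fun t ht hSt => ⟨hSt, fun x hx hxc => ?_⟩⟩
    have h1 := hp t ht hSt (x * ψ t) (by have := hψ t; positivity)
    rw [mul_div_cancel_right₀ _ (hψ t).ne'] at h1
    have hkx : k ≤ gpdSurvival ξ x := antitone_gpdSurvival ξ hxc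
    have hpos : 0 < S (t + x * ψ t) := by
      have h2 := (abs_le.1 h1).1
      have h3 : δ ≤ k / 2 := min_le_left _ _
      have : (k - δ) * S t ≤ (gpdSurvival ξ x - δ) * S t := by gcongr
      have : 0 < (k - δ) * S t := mul_pos (by linarith) hSt
      nlinarith
    refine ⟨hpos, ?_, hp t ht hSt⟩
    have hle : T ≤ t + x * ψ t := by nlinarith [hψ t]
    have h4 := hp _ hle hpos (c * ψ (t + x * ψ t)) (by have := hψ (t + x * ψ t); positivity)
    rwa [mul_div_cancel_right₀ _ (hψ _).ne'] at h4
  · rintro t hSt ⟨-, hp⟩ x hx hxc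
    obtain ⟨hpos, h1, h2⟩ := hp x hx hxc
    refine ⟨hpos, ?_⟩
    have hψt := hψ t
    set t' := t + x * ψ t with ht'
    have hψt' := hψ t'
    have hd : 0 < 1 + ξ * x := by
      rcases le_or_gt 0 ξ with h0 | h0
      · positivity
      · nlinarith
    have hd' : 1 + x * ξ ≠ 0 := by rw [mul_comm]; exact hd.ne'
    -- z is the step cψ(t') in units of the predicted scale (1+ξx)ψ(t). Comparing the two routes
    -- gives K(z) ≈ K(c), hence z ≈ c.
    set z := c * ψ t' / (ψ t * (1 + ξ * x)) with hz
    have hz0 : 0 < z := by positivity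
    have hadd := gpdSurvival_add hx hz0.le hd
    have h3 := h2 (x * ψ t + c * ψ t') (by positivity)
    have hq : (x * ψ t + c * ψ t') / ψ t = x + (1 + ξ * x) * z := by
      rw [hz]; field_simp
    rw [hq, hadd, ← add_assoc, ← ht'] at h3
    have h4 := h2 (x * ψ t) (by positivity)
    rw [mul_div_cancel_right₀ _ hψt.ne', ← ht'] at h4
    have hkx : k ≤ gpdSurvival ξ x := antitone_gpdSurvival ξ hxc
    have hSt' : S t' ≤ S t := hS (by rw [ht']; nlinarith)
    have hk1 : k ≤ 1 := gpdSurvival_le_one _ _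
    have hmain : k * |gpdSurvival ξ z - k| ≤ 3 * δ := by
      have e1 : gpdSurvival ξ x * (gpdSurvival ξ z - k) * S t =
          -(S (t' + c * ψ t') - gpdSurvival ξ x * gpdSurvival ξ z * S t) +
          (S (t' + c * ψ t') - k * S t') + k * (S t' - gpdSurvival ξ x * S t) := by ring
      have e2 : |gpdSurvival ξ x * (gpdSurvival ξ z - k) * S t| ≤ 3 * δ * S t := by
        rw [e1]
        refine (abs_add_three _ _ _).trans ?_
        rw [abs_neg, abs_mul k, abs_of_pos hk0]
        have e3 : k * |S t' - gpdSurvival ξ x * S t| ≤ 1 * (δ * S t) := by gcongr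
        have e4 : δ * S t' ≤ δ * S t := by gcongr
        linarith
      rw [abs_mul, abs_mul, abs_of_pos hSt, abs_of_pos (hk0.trans_le hkx)] at e2
      have e5 := le_of_mul_le_mul_right e2 hSt
      exact (mul_le_mul_of_nonneg_right hkx (abs_nonneg _)).trans e5
    have hlt : |gpdSurvival ξ z - k| < m := by
      have : δ ≤ m * k / 4 := min_le_right _ _
      have : 0 < m * k := by positivity
      by_contra! hcon
      nlinarith
    have hlt' := abs_lt.1 hlt
    have hma : m ≤ gpdSurvival ξ (c * (1 - e)) - k := min_le_left _ _
    have hmb : m ≤ k - gpdSurvival ξ (c * (1 + e)) := min_le_right _ _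
    have hz1 : c * (1 - e) < z := (antitone_gpdSurvival ξ).reflect_lt (by linarith)
    have hz2 : z < c * (1 + e) := (antitone_gpdSurvival ξ).reflect_lt (by linarith)
    have hzz : ψ t' = z / c * ((1 + ξ * x) * ψ t) := by rw [hz]; field_simp
    have hzc : |z / c - 1| ≤ e := by
      rw [abs_le]
      constructor
      · have := (le_div_iff₀' hc).2 hz1.le
        linarith
      · have := (div_le_iff₀' hc).2 hz2.le
        linarith
    have hdB : 1 + ξ * x ≤ B := by
      have : ξ * x ≤ |ξ| * c := mul_le_mul (le_abs_self _) hxc hx (abs_nonneg _)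
      linarith
    calc |ψ t' - (1 + ξ * x) * ψ t| = |z / c - 1| * ((1 + ξ * x) * ψ t) := by
          rw [hzz, ← abs_of_pos (show 0 < (1 + ξ * x) * ψ t by positivity), ← abs_mul,
            abs_of_pos (show 0 < (1 + ξ * x) * ψ t by positivity)]
          congr 1; ring
      _ ≤ ε / B * (B * ψ t) := by
          gcongr
          exact hzc.trans he1
      _ = ε * ψ t := by field_simp

theorem IsGPDTail.eventually_contract (h : IsGPDTail S ξ ψ) (hψ : ∀ t, 0 < ψ t) {c : ℝ}
    (hc : 0 < c) (hξc : 0 < 1 + ξ * c) :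
    ∃ q, 0 ≤ q ∧ q < 1 ∧
      EventuallyTail S fun t => 0 < S (t + c * ψ t) ∧ S (t + c * ψ t) ≤ q * S t := by
  have hk0 := gpdSurvival_pos hξc
  have hk1 : gpdSurvival ξ c < 1 := by
    rw [← gpdSurvival_of_nonpos (ξ := ξ) le_rfl]
    exact gpdSurvival_lt_of_lt hc hc hξc
  set k := gpdSurvival ξ c
  set δ := min (k / 2) ((1 - k) / 2) with hδ
  have hδ0 : 0 < δ := lt_min (by linarith) (by linarith)
  have hd1 : δ ≤ k / 2 := min_le_left _ _
  have hd2 : δ ≤ (1 - k) / 2 := min_le_right _ _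
  refine ⟨k + δ, by linarith, by linarith, (h δ hδ0).mono fun t hSt hp => ?_⟩
  have h1 := abs_le.1 (hp (c * ψ t) (by have := hψ t; positivity))
  rw [mul_div_cancel_right₀ _ (hψ t).ne'] at h1
  have : 0 < (k - δ) * S t := mul_pos (by linarith) hSt
  constructor <;> [nlinarith [h1.1]; nlinarith [h1.2]]

/-- The orbit of thresholds obtained by repeatedly adding `c` times the current scale. -/
def scaleOrbit (ψ : ℝ → ℝ) (c t : ℝ) (n : ℕ) : ℝ := (fun s => s + c * ψ s)^[n] t

theorem scaleOrbit_zero (c t : ℝ) : scaleOrbit ψ c t 0 = t := rfl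

theorem scaleOrbit_succ (c t : ℝ) (n : ℕ) :
    scaleOrbit ψ c t (n + 1) = scaleOrbit ψ c t n + c * ψ (scaleOrbit ψ c t n) :=
  Function.iterate_succ_apply' _ _ _

theorem scaleOrbit_mem (hψ : ∀ t, 0 < ψ t) {c q T t : ℝ} (hc : 0 < c) (hq : 0 ≤ q)
    (hstep : ∀ t, T ≤ t → 0 < S t → 0 < S (t + c * ψ t) ∧ S (t + c * ψ t) ≤ q * S t)
    (ht : T ≤ t) (hSt : 0 < S t) (n : ℕ) :
    t ≤ scaleOrbit ψ c t n ∧ 0 < S (scaleOrbit ψ c t n) ∧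
      S (scaleOrbit ψ c t n) ≤ q ^ n * S t := by
  induction n with
  | zero => simp [scaleOrbit_zero, hSt]
  | succ n ih =>
    obtain ⟨h1, h2, h3⟩ := ih
    obtain ⟨h4, h5⟩ := hstep _ (ht.trans h1) h2
    rw [scaleOrbit_succ]
    refine ⟨by nlinarith [hψ (scaleOrbit ψ c t n)], h4, h5.trans ?_⟩
    rw [pow_succ', mul_assoc]
    gcongr

theorem tendsto_pow_mul_zero {q : ℝ} (hq : 0 ≤ q) (hq1 : q < 1) (s : ℝ) :
    Tendsto (fun n : ℕ => q ^ n * s) atTop (𝓝 0) := by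
  simpa using (tendsto_pow_atTop_nhds_zero_of_lt_one hq hq1).mul_const s

theorem IsGPDTail.exists_small (h : IsGPDTail S ξ ψ) (hψ : ∀ t, 0 < ψ t) {δ : ℝ} (hδ : 0 < δ) :
    ∃ t, 0 < S t ∧ S t < δ := by
  obtain ⟨c, hc, hξc⟩ : ∃ c > 0, 0 < 1 + ξ * c := by
    refine ⟨1 / (1 + |ξ|), by positivity, ?_⟩
    have : 1 + ξ * (1 / (1 + |ξ|)) = (1 + (|ξ| + ξ)) / (1 + |ξ|) := by field_simp; ring
    rw [this]
    have := neg_abs_le ξ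
    exact div_pos (by linarith) (by positivity)
  obtain ⟨q, hq, hq1, T, hT, hstep⟩ := h.eventually_contract hψ hc hξc
  obtain ⟨n, hn⟩ := ((tendsto_pow_mul_zero hq hq1 (S T)).eventually (gt_mem_nhds hδ)).exists
  obtain ⟨-, h2, h3⟩ := scaleOrbit_mem hψ hc hq hstep le_rfl hT n
  exact ⟨_, h2, h3.trans_lt hn⟩

/-- Since K(M) > 0, a conditional tail that vanishes at a - t forces a - t to exceed Mψ(t). -/
theorem IsGPDTail.eventually_mul_scale_le (h : IsGPDTail S ξ ψ) (hS : Antitone S)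
    (hψ : ∀ t, 0 < ψ t) {a : ℝ} (ha : S a = 0) {M : ℝ} (hM : 0 < 1 + ξ * M) :
    EventuallyTail S fun t => M * ψ t ≤ a - t := by
  have hk := gpdSurvival_pos hM
  refine (h _ (half_pos hk)).mono fun t hSt hp => ?_
  have hta : t < a := hS.reflect_lt (by rwa [ha])
  have h1 := hp (a - t) (by linarith)
  rw [add_sub_cancel, ha, zero_sub, abs_neg, abs_of_nonneg
    (mul_nonneg (gpdSurvival_nonneg _ _) hSt.le)] at h1
  have h2 := le_of_mul_le_mul_right h1 hSt
  have h3 : M < (a - t) / ψ t := (antitone_gpdSurvival ξ).reflect_lt (by linarith)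
  exact ((lt_div_iff₀ (hψ t)).1 h3).le

theorem IsGPDTail.pos_of_shape_pos (h : IsGPDTail S ξ ψ) (hS : Antitone S) (hS0 : ∀ t, 0 ≤ S t)
    (hψ : ∀ t, 0 < ψ t) (hξ : 0 < ξ) (a : ℝ) : 0 < S a := by
  by_contra! ha
  have ha0 : S a = 0 := le_antisymm ha (hS0 a)
  -- With tolerance ξ, one step gives ψ(t+ψ(t)) ≥ ψ(t). The orbit thus advances by at least ψ(T)
  -- each time and passes a with S still positive.
  obtain ⟨T, hT, hstep⟩ := h.eventually_scale_step hS hψ one_pos (by linarith) hξ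
  have horb : ∀ n : ℕ, T + n * ψ T ≤ scaleOrbit ψ 1 T n ∧ ψ T ≤ ψ (scaleOrbit ψ 1 T n) ∧
      0 < S (scaleOrbit ψ 1 T n) := by
    intro n
    induction n with
    | zero => simp [scaleOrbit_zero, hT]
    | succ n ih =>
      obtain ⟨h1, h2, h3⟩ := ih
      have hn : (0 : ℝ) ≤ n * ψ T := mul_nonneg n.cast_nonneg (hψ T).le
      obtain ⟨h4, h5⟩ := hstep _ (by linarith) h3 1 zero_le_one le_rfl
      rw [scaleOrbit_succ]
      refine ⟨?_, ?_, h4⟩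
      · push_cast; linarith
      · have := (abs_le.1 h5).1
        linarith
  obtain ⟨n, hn⟩ := exists_nat_gt ((a - T) / ψ T)
  obtain ⟨h1, -, h3⟩ := horb n
  rw [div_lt_iff₀ (hψ T)] at hn
  have := hS (show a ≤ scaleOrbit ψ 1 T n by linarith)
  linarith

theorem IsGPDTail.eventually_abs_scale_sub_le_of_forall_pos (h : IsGPDTail S ξ ψ)
    (hS : Antitone S) (hψ : ∀ t, 0 < ψ t) (hξ : 0 ≤ ξ) (hpos : ∀ t, 0 < S t) {ε : ℝ}
    (hε : 0 < ε) : EventuallyTail S fun t => |ψ t - ξ * t| ≤ ε * t := by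
  set e := min 1 (ε / (2 * (2 + ξ))) with he
  have he0 : 0 < e := by positivity
  have he1 : e ≤ 1 := min_le_left _ _
  have he2 : e * (2 + ξ) ≤ ε / 2 := by
    calc e * (2 + ξ) ≤ ε / (2 * (2 + ξ)) * (2 + ξ) := by
          gcongr; exact min_le_right _ _
      _ = ε / 2 := by field_simp
  obtain ⟨q, hq, hq1, hcontr⟩ := h.eventually_contract hψ one_pos (by linarith)
  obtain ⟨T', -, hboth⟩ := hcontr.and
    (h.eventually_scale_step hS hψ one_pos (by linarith) he0)
  set T := max T' 0 with hT
  have hT0 : 0 ≤ T := le_max_right _ _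
  have hTT : T' ≤ T := le_max_left _ _
  set u := scaleOrbit ψ 1 T with hu
  have hmem := scaleOrbit_mem hψ one_pos hq (fun t ht hSt => (hboth t ht hSt).1) hTT (hpos T)
  set C := |ψ T - ξ * T| with hC
  -- Each step changes ψ - ξ·id by at most eψ(u n), which is e times the increment of the orbit, so
  -- the errors telescope.
  have hv : ∀ n, |ψ (u n) - ξ * u n| ≤ C + e * (u n - T) := by
    intro n
    induction n with
    | zero => simp [hu, scaleOrbit_zero, hC]
    | succ n ih =>
      obtain ⟨-, h2⟩ := (hboth (u n) (hTT.trans (hmem n).1) (hpos _)).2 1 zero_le_one le_rfl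
      have hs : u (n + 1) = u n + 1 * ψ (u n) := scaleOrbit_succ _ _ _
      rw [← hs] at h2
      have e1 : ψ (u (n + 1)) - ξ * u (n + 1) =
          (ψ (u n) - ξ * u n) + (ψ (u (n + 1)) - (1 + ξ * 1) * ψ (u n)) := by
        rw [hs]; ring
      rw [e1]
      refine (abs_add_le _ _).trans ?_
      have e2 : e * (u (n + 1) - T) = e * (u n - T) + e * ψ (u n) := by rw [hs]; ring
      linarith
  have hunb : ∀ L, ∃ n, L < u n := by
    intro L
    by_contra! hc
    have : S L ≤ 0 := ge_of_tendsto' (tendsto_pow_mul_zero hq hq1 (S T)) fun n =>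
      (hS (hc n)).trans (hmem n).2.2
    exact absurd (hpos L) (not_lt.2 this)
  refine ⟨max T (4 * C / ε), hpos _, fun t ht _ => ?_⟩
  have hTt : T ≤ t := (le_max_left _ _).trans ht
  have hCt : 4 * C ≤ ε * t := (div_le_iff₀' hε).1 ((le_max_right _ _).trans ht)
  -- A general t lies within one step of an orbit point; uniformity of the step estimate in x ∈
  -- [0,1] transfers the bound.
  obtain ⟨n, hn1, hn2⟩ : ∃ n, u n ≤ t ∧ t < u (n + 1) := by
    classical
    have hex := hunb t
    have hne : Nat.find hex ≠ 0 := by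
      intro h0
      have := Nat.find_spec hex
      rw [h0] at this
      exact absurd hTt (not_le.2 this)
    obtain ⟨n, hn⟩ := Nat.exists_eq_succ_of_ne_zero hne
    refine ⟨n, not_lt.1 (Nat.find_min hex (by omega)), ?_⟩
    have := Nat.find_spec hex
    rwa [hn] at this
  have hs : u (n + 1) = u n + 1 * ψ (u n) := scaleOrbit_succ _ _ _
  have hψn := hψ (u n)
  have hx1 : (t - u n) / ψ (u n) ≤ 1 := (div_le_one hψn).2 (by linarith)
  obtain ⟨-, h2⟩ := (hboth (u n) (hTT.trans (hmem n).1) (hpos _)).2 ((t - u n) / ψ (u n))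
    (div_nonneg (by linarith) hψn.le) hx1
  have e0 : u n + (t - u n) / ψ (u n) * ψ (u n) = t := by field_simp; ring
  have e1 : (1 + ξ * ((t - u n) / ψ (u n))) * ψ (u n) = ψ (u n) + ξ * (t - u n) := by
    field_simp
  rw [e0, e1] at h2
  have hvn := hv n
  have hun : T ≤ u n := (hmem n).1
  have e2 : |ψ t - ξ * t| ≤ |ψ (u n) - ξ * u n| + e * ψ (u n) := by
    have : ψ t - ξ * t = (ψ (u n) - ξ * u n) + (ψ t - (ψ (u n) + ξ * (t - u n))) := by ring
    rw [this]
    exact (abs_add_le _ _).trans (by linarith)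
  have hC0 : 0 ≤ C := abs_nonneg _
  have e3 : |ψ (u n) - ξ * u n| ≤ C + e * t := hvn.trans (by gcongr; linarith)
  have e4 : ψ (u n) ≤ C + t + ξ * t := by
    have a1 := (abs_le.1 e3).2
    have a2 : ξ * u n ≤ ξ * t := by gcongr
    have a3 : e * t ≤ 1 * t := by gcongr; linarith
    linarith
  have e5 : e * ψ (u n) ≤ C + e * (t + ξ * t) := by
    have a1 : e * ψ (u n) ≤ e * (C + t + ξ * t) := by gcongr
    have a2 : e * C ≤ 1 * C := by gcongr
    linarith
  have e6 : e * (2 + ξ) * t ≤ ε / 2 * t := by gcongr; linarith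
  linarith

theorem IsGPDTail.eventually_abs_scale_sub_le (h : IsGPDTail S ξ ψ) (hS : Antitone S)
    (hS0 : ∀ t, 0 ≤ S t) (hψ : ∀ t, 0 < ψ t) (hξ : 0 ≤ ξ) {T : ℝ} (hT : 0 < T) (hST : 0 < S T)
    {ε : ℝ} (hε : 0 < ε) : EventuallyTail S fun t => |ψ t - ξ * t| ≤ ε * t := by
  by_cases hpos : ∀ t, 0 < S t
  · exact h.eventually_abs_scale_sub_le_of_forall_pos hS hψ hξ hpos hε
  push Not at hpos
  obtain ⟨a, ha⟩ := hpos
  obtain rfl : ξ = 0 := by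
    by_contra hne
    exact absurd (h.pos_of_shape_pos hS hS0 hψ (lt_of_le_of_ne hξ (Ne.symm hne)) a) (not_lt.2 ha)
  have ha0 : S a = 0 := le_antisymm ha (hS0 a)
  have hTa : T < a := hS.reflect_lt (by rwa [ha0])
  have ha1 : 0 < a := hT.trans hTa
  -- This M turns Mψ(t) ≤ a - t ≤ a into ψ(t) ≤ εT ≤ εt.
  refine ((h.eventually_mul_scale_le hS hψ ha0 (M := a / (ε * T)) (by simp)).and
    (eventuallyTail_ge hST)).mono fun t _ ⟨h1, h2⟩ => ?_
  rw [zero_mul, sub_zero, abs_of_pos (hψ t)]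
  rw [div_mul_eq_mul_div, div_le_iff₀ (by positivity)] at h1
  have h3 : a * ψ t ≤ a * (ε * T) := h1.trans (by gcongr; linarith)
  exact (le_of_mul_le_mul_left h3 ha1).trans (by gcongr)

theorem IsGPDTail.eventually_eq_zero_of_shape_neg (h : IsGPDTail S ξ ψ) (hS : Antitone S)
    (hS0 : ∀ t, 0 ≤ S t) (hψ : ∀ t, 0 < ψ t) (hξ : ξ < 0) {η : ℝ} (hη : 0 < η) :
    EventuallyTail S fun t => S (t + (1 + η) / -ξ * ψ t) = 0 := by
  -- With this c, 1+ξc = 1/2: each step roughly halves the scale.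
  set c := 1 / (2 * -ξ) with hc
  have hξ' : 0 < -ξ := by linarith
  have hξ0 : ξ ≠ 0 := hξ.ne
  have hc0 : 0 < c := by positivity
  have hξc : 1 + ξ * c = 1 / 2 := by rw [hc]; field_simp; ring
  obtain ⟨q, hq, hq1, hcontr⟩ := h.eventually_contract hψ hc0 (by rw [hξc]; norm_num)
  obtain ⟨T, hT, hboth⟩ := hcontr.and (h.eventually_scale_step hS hψ hc0
    (by rw [hξc]; norm_num) (show 0 < η / (2 * (1 + η)) by positivity))
  refine ⟨T, hT, fun t ht hSt => ?_⟩
  have hmem := scaleOrbit_mem hψ hc0 hq (fun t ht hSt => (hboth t ht hSt).1) ht hSt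
  set u := scaleOrbit ψ c t with hu
  set b := (1 + η) / -ξ with hb
  have hb0 : 0 < b := by positivity
  -- The tolerance η/(2(1+η)) is the one for which u+bψ(u) does not increase along the orbit. The
  -- orbit stays below t+bψ(t) while S tends to 0 on it.
  have hL : ∀ n, u n + b * ψ (u n) ≤ t + b * ψ t := by
    intro n
    induction n with
    | zero => simp [hu, scaleOrbit_zero]
    | succ n ih =>
      refine le_trans ?_ ih
      obtain ⟨-, h2⟩ := (hboth (u n) (ht.trans (hmem n).1) (hmem n).2.1).2 c hc0.le le_rfl
      have hs : u (n + 1) = u n + c * ψ (u n) := scaleOrbit_succ _ _ _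
      rw [← hs, hξc] at h2
      have h3 : ψ (u (n + 1)) ≤ (1 / 2 + η / (2 * (1 + η))) * ψ (u n) := by
        linarith [(abs_le.1 h2).2]
      have h4 : b * ψ (u (n + 1)) ≤ b * ((1 / 2 + η / (2 * (1 + η))) * ψ (u n)) := by gcongr
      have h5 : c + b * (1 / 2 + η / (2 * (1 + η))) = b := by
        rw [hb, hc]; field_simp; ring
      rw [hs] at h4 ⊢
      have h6 : b * ψ (u n) = c * ψ (u n) + b * ((1 / 2 + η / (2 * (1 + η))) * ψ (u n)) := by
        nth_rewrite 1 [← h5]; ring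
      linarith
  refine le_antisymm ?_ (hS0 _)
  refine ge_of_tendsto' (tendsto_pow_mul_zero hq hq1 (S t)) fun n => ?_
  refine (hS ?_).trans (hmem n).2.2
  have := mul_pos hb0 (hψ (u n))
  linarith [hL n]

/-- S vanishes at t+(1+η)ψ(t)/(-ξ), while K is still positive at (1-η)/(-ξ); the endpoint is trapped
between. -/
theorem IsGPDTail.eventually_abs_endpoint_sub_le (h : IsGPDTail S ξ ψ) (hS : Antitone S)
    (hS0 : ∀ t, 0 ≤ S t) (hψ : ∀ t, 0 < ψ t) (hξ : ξ < 0) {a : ℝ} (ha : S a = 0)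
    (hpos : ∀ t < a, 0 < S t) {η : ℝ} (hη : 0 < η) :
    EventuallyTail S fun t => |-ξ * (a - t) - ψ t| ≤ η * ψ t := by
  have hξ' : 0 < -ξ := by linarith
  have hξ0 : ξ ≠ 0 := hξ.ne
  refine ((h.eventually_eq_zero_of_shape_neg hS hS0 hψ hξ hη).and
    (h.eventually_mul_scale_le hS hψ ha (M := (1 - η) / -ξ) ?_)).mono fun t _ ⟨h1, h2⟩ => ?_
  · have : 1 + ξ * ((1 - η) / -ξ) = η := by field_simp; ring
    rwa [this]
  · have h3 : a ≤ t + (1 + η) / -ξ * ψ t := by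
      by_contra! hc
      exact (hpos _ hc).ne' h1
    have e1 : -ξ * ((1 + η) / -ξ * ψ t) = (1 + η) * ψ t := by field_simp
    have e2 : -ξ * ((1 - η) / -ξ * ψ t) = (1 - η) * ψ t := by field_simp
    have h4 : -ξ * (a - t) ≤ -ξ * ((1 + η) / -ξ * ψ t) := by gcongr; linarith
    have h5 := mul_le_mul_of_nonneg_left h2 hξ'.le
    rw [abs_le]; constructor <;> linarith

theorem IsGPDTail.congr_scale {φ : ℝ → ℝ} (h : IsGPDTail S ξ ψ) (hψ : ∀ t, 0 < ψ t)
    (hφ : ∀ η > 0, EventuallyTail S fun t => |φ t - ψ t| ≤ η * ψ t) : IsGPDTail S ξ φ := by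
  intro ε hε
  obtain ⟨η, hη, hK⟩ := exists_forall_abs_gpdSurvival_mul_sub_le ξ (half_pos hε)
  -- The instance 1/2 supplies the positivity of φ t, which is not assumed.
  refine ((h _ (half_pos hε)).and ((hφ η hη).and (hφ (1 / 2) (by norm_num)))).mono
    fun t hSt ⟨h1, h2, h3⟩ x hx => ?_
  have hψt := hψ t
  have hφt : 0 < φ t := by linarith [(abs_le.1 h3).1]
  have hr : |φ t / ψ t - 1| ≤ η := by
    have : φ t / ψ t - 1 = (φ t - ψ t) / ψ t := by field_simp
    rw [this, abs_div, abs_of_pos hψt]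
    exact (div_le_iff₀ hψt).2 h2
  have h4 := hK _ hr (x / φ t) (by positivity)
  have e1 : φ t / ψ t * (x / φ t) = x / ψ t := by field_simp
  rw [e1] at h4
  have h5 := h1 x hx
  have e2 : S (t + x) - gpdSurvival ξ (x / φ t) * S t =
      (S (t + x) - gpdSurvival ξ (x / ψ t) * S t) +
      (gpdSurvival ξ (x / ψ t) - gpdSurvival ξ (x / φ t)) * S t := by ring
  rw [e2]
  refine (abs_add_le _ _).trans ?_
  rw [abs_mul, abs_of_pos hSt]
  have h6 := mul_le_mul_of_nonneg_right h4 hSt.le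
  linarith

end Tail

/-! ### Tails under the reciprocal -/

section Transform

variable {S S' ψ ψ' : ℝ → ℝ} {ξ : ℝ}

theorem EventuallyTail.neg_inv {p : ℝ → Prop} (hp : EventuallyTail S p) {T₀ : ℝ} (hT₀ : 0 < T₀)
    (hST₀ : 0 < S T₀) (hneg : ∀ s < 0, S' s = S (-1 / s)) (hnonneg : ∀ s, 0 ≤ s → S' s = 0) :
    EventuallyTail S' fun s => s < 0 ∧ p (-1 / s) := by
  obtain ⟨T, hT, h⟩ := hp.and (eventuallyTail_ge hST₀)
  have hT0 : 0 < T ⊔ T₀ := lt_max_of_lt_right hT₀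
  have hST : 0 < S (T ⊔ T₀) := by
    rcases max_choice T T₀ with hm | hm <;> rw [hm] <;> assumption
  refine ⟨-1 / (T ⊔ T₀), ?_, fun s hs hSs => ?_⟩
  · rw [hneg _ (div_neg_of_neg_of_pos (by norm_num) hT0)]
    rwa [show -1 / (-1 / (T ⊔ T₀)) = T ⊔ T₀ by field_simp]
  · have hs0 : s < 0 := by
      by_contra! hc
      exact hSs.ne' (hnonneg s hc)
    refine ⟨hs0, (h (-1 / s) ?_ (by rwa [← hneg s hs0])).1⟩
    refine (le_max_left T T₀).trans ?_
    rw [div_le_iff₀ hT0] at hs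
    rw [le_div_iff_of_neg hs0]
    linarith

theorem EventuallyTail.inv_endpoint_sub {p : ℝ → Prop} (hp : EventuallyTail S p)
    (hS : Antitone S) {a : ℝ} (ha : S a = 0) (hpos : ∀ s, 0 < s → S' s = S (a - 1 / s)) :
    EventuallyTail S' fun s => 0 < s ∧ p (a - 1 / s) := by
  obtain ⟨T, hT, h⟩ := hp
  have hTa : 0 < a - T := sub_pos.2 (hS.reflect_lt (by rwa [ha]))
  refine ⟨1 / (a - T), ?_, fun s hs hSs => ?_⟩
  · rw [hpos _ (by positivity), one_div_one_div, sub_sub_cancel]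
    exact hT
  · have hs0 : 0 < s := (by positivity : 0 < 1 / (a - T)).trans_le hs
    refine ⟨hs0, h _ ?_ (by rwa [← hpos s hs0])⟩
    have := (one_div_le hTa hs0).1 hs
    linarith

theorem IsGPDTail.neg_inv_of_shape_pos (h : IsGPDTail S ξ fun t => ξ * t) (hξ : 0 < ξ) {T₀ : ℝ}
    (hT₀ : 0 < T₀) (hST₀ : 0 < S T₀) (hneg : ∀ s < 0, S' s = S (-1 / s))
    (hnonneg : ∀ s, 0 ≤ s → S' s = 0) (hψ' : ∀ s < 0, ψ' s = -ξ * s) :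
    IsGPDTail S' (-ξ) ψ' := by
  intro ε hε
  refine ((h ε hε).neg_inv hT₀ hST₀ hneg hnonneg).mono fun s hSs ⟨hs, hp⟩ y hy => ?_
  have hs' : 0 < -s := by linarith
  have hs0 : s ≠ 0 := hs.ne
  have hw : 0 ≤ y / (-ξ * s) := div_nonneg hy (by nlinarith)
  rw [hψ' s hs]
  rcases lt_or_ge (s + y) 0 with hsy | hsy
  · have hsy0 : s + y ≠ 0 := hsy.ne
    have e0 : 1 - ξ * (y / (-ξ * s)) = (s + y) / s := by field_simp; ring
    have h1 := hp (-1 / (s + y) - -1 / s) (by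
      have : -1 / (s + y) - -1 / s = y / (s * (s + y)) := by field_simp; ring
      rw [this]
      exact div_nonneg hy (mul_nonneg_of_nonpos_of_nonpos hs.le hsy.le))
    have e1 : (-1 / (s + y) - -1 / s) / (ξ * (-1 / s)) =
        y / (-ξ * s) / (1 - ξ * (y / (-ξ * s))) := by
      rw [e0]; field_simp; ring
    rw [e1, gpdSurvival_div_one_sub hξ.ne' hw (by rw [e0]; exact div_pos_of_neg_of_neg hsy hs),
      add_sub_cancel, ← hneg s hs, ← hneg _ hsy] at h1
    exact h1
  -- At or beyond the endpoint 0 of the reciprocal, both tails vanish.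
  · rw [hnonneg _ hsy, gpdSurvival_eq_zero _ hw]
    · simp only [zero_mul, sub_zero, abs_zero]; positivity
    · have : 1 + -ξ * (y / (-ξ * s)) = (s + y) / s := by field_simp
      rw [this]
      exact div_nonpos_of_nonneg_of_nonpos hsy hs.le

theorem exists_forall_abs_exp_neg_sub_le {ε : ℝ} (hε : 0 < ε) :
    ∃ η > 0, ∀ τ w : ℝ, 0 < τ → τ ≤ η → 0 ≤ w →
      (τ * w < 1 → |Real.exp (-(w / (1 - τ * w))) - Real.exp (-w)| ≤ ε) ∧
      (1 ≤ τ * w → Real.exp (-w) ≤ ε) := by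
  obtain ⟨M, hM, hM0⟩ := ((Real.tendsto_exp_neg_atTop_nhds_zero.eventually
    (gt_mem_nhds hε)).and (eventually_gt_atTop 0)).exists
  -- For w < M, τw ≤ 1/2 and the exponents differ by τw²/(1-τw) ≤ 2τM² ≤ ε. For w ≥ M the
  -- exponentials are below ε, and τw ≥ 1 forces w ≥ M.
  refine ⟨min (1 / (2 * M)) (ε / (2 * M ^ 2)), by positivity, fun τ w hτ hτη hw => ?_⟩
  have h1 : τ ≤ 1 / (2 * M) := hτη.trans (min_le_left _ _)
  have h2 : τ ≤ ε / (2 * M ^ 2) := hτη.trans (min_le_right _ _)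
  rw [le_div_iff₀ (by positivity)] at h1 h2
  have hlarge : M ≤ w → Real.exp (-w) ≤ ε := fun h =>
    (Real.exp_le_exp.2 (neg_le_neg h)).trans hM.le
  constructor
  · intro h
    have hd : 0 < 1 - τ * w := by linarith
    have hle : w ≤ w / (1 - τ * w) := by
      rw [le_div_iff₀ hd]
      nlinarith [mul_nonneg hτ.le (mul_nonneg hw hw)]
    have hexp : Real.exp (-(w / (1 - τ * w))) ≤ Real.exp (-w) := Real.exp_le_exp.2 (by linarith)
    rw [abs_sub_comm, abs_of_nonneg (by linarith)]
    rcases le_or_gt M w with hMw | hMw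
    · linarith [hlarge hMw, Real.exp_pos (-(w / (1 - τ * w)))]
    · have hd2 : 1 / 2 ≤ 1 - τ * w := by nlinarith
      have hdiff : w / (1 - τ * w) - w ≤ ε := by
        have : w / (1 - τ * w) - w = τ * w ^ 2 / (1 - τ * w) := by
          rw [eq_div_iff hd.ne', sub_mul, div_mul_cancel₀ _ hd.ne']; ring
        rw [this, div_le_iff₀ hd]
        have : τ * w ^ 2 ≤ τ * M ^ 2 := by gcongr
        nlinarith
      have e1 : Real.exp (-(w / (1 - τ * w))) =
          Real.exp (-w) * Real.exp (-(w / (1 - τ * w) - w)) := by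
        rw [← Real.exp_add]; ring_nf
      have e2 := Real.add_one_le_exp (-(w / (1 - τ * w) - w))
      have e3 : Real.exp (-w) ≤ 1 := Real.exp_le_one_iff.2 (by linarith)
      have e4 := mul_le_mul_of_nonneg_left e2 (Real.exp_pos (-w)).le
      have e5 : Real.exp (-w) * (w / (1 - τ * w) - w) ≤ 1 * (w / (1 - τ * w) - w) := by
        gcongr
      rw [e1]
      linarith
  · intro h
    refine hlarge ?_
    by_contra! hc
    nlinarith

/-- The scale s²ψ(-1/s) is ψ divided by the derivative 1/s² of s ↦ -1/s. The perturbation parameter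
τ = -sψ(-1/s) is ψ(t)/t at t = -1/s. -/
theorem IsGPDTail.neg_inv_of_shape_zero (h : IsGPDTail S 0 ψ) (hψ : ∀ t, 0 < ψ t)
    (hψt : ∀ ε > 0, EventuallyTail S fun t => ψ t ≤ ε * t) {T₀ : ℝ}
    (hT₀ : 0 < T₀) (hST₀ : 0 < S T₀) (hneg : ∀ s < 0, S' s = S (-1 / s))
    (hnonneg : ∀ s, 0 ≤ s → S' s = 0) (hψ' : ∀ s < 0, ψ' s = s ^ 2 * ψ (-1 / s)) :
    IsGPDTail S' 0 ψ' := by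
  intro ε hε
  obtain ⟨η, hη, hE⟩ := exists_forall_abs_exp_neg_sub_le (half_pos hε)
  refine (((h _ (half_pos hε)).and (hψt η hη)).neg_inv hT₀ hST₀ hneg hnonneg).mono
    fun s hSs ⟨hs, hp, hτ⟩ y hy => ?_
  have hs' : 0 < -s := by linarith
  have hs0 : s ≠ 0 := hs.ne
  rw [hψ' s hs]
  have hψs := hψ (-1 / s)
  set p := ψ (-1 / s) with hpdef
  have hw : 0 ≤ y / (s ^ 2 * p) := by positivity
  have hτη : -s * p ≤ η := by
    rw [← mul_div_assoc, le_div_iff_of_neg hs] at hτ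
    linarith
  obtain ⟨hE1, hE2⟩ := hE (-s * p) (y / (s ^ 2 * p)) (by positivity) hτη hw
  have eτ : -s * p * (y / (s ^ 2 * p)) = y / -s := by field_simp
  rw [eτ] at hE1 hE2
  rw [gpdSurvival_zero_shape hw]
  rcases lt_or_ge (s + y) 0 with hsy | hsy
  · have hsy0 : s + y ≠ 0 := hsy.ne
    have hx : 0 ≤ -1 / (s + y) - -1 / s := by
      have : -1 / (s + y) - -1 / s = y / (s * (s + y)) := by field_simp; ring
      rw [this]
      exact div_nonneg hy (mul_nonneg_of_nonpos_of_nonpos hs.le hsy.le)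
    have h1 := hp _ hx
    have h2 := hE1 ((div_lt_one hs').2 (by linarith))
    have e0 : 1 - y / -s = (s + y) / s := by field_simp; ring
    have e1 : y / (s ^ 2 * p) / (1 - y / -s) = (-1 / (s + y) - -1 / s) / p := by
      rw [e0]; field_simp; ring
    rw [gpdSurvival_zero_shape (by positivity), add_sub_cancel, ← hneg s hs, ← hneg _ hsy] at h1
    rw [e1] at h2
    set A := Real.exp (-((-1 / (s + y) - -1 / s) / p))
    set B := Real.exp (-(y / (s ^ 2 * p)))
    have e2 : S' (s + y) - B * S' s = (S' (s + y) - A * S' s) + (A - B) * S' s := by ring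
    rw [e2]
    refine (abs_add_le _ _).trans ?_
    rw [abs_mul, abs_of_pos hSs]
    have h6 := mul_le_mul_of_nonneg_right h2 hSs.le
    linarith
  · have h2 := hE2 ((one_le_div hs').2 (by linarith))
    rw [hnonneg _ hsy, zero_sub, abs_neg, abs_of_nonneg (by positivity)]
    gcongr
    linarith

theorem IsGPDTail.inv_endpoint_sub {a : ℝ} (h : IsGPDTail S ξ fun t => -ξ * (a - t))
    (hS : Antitone S) (hξ : ξ < 0) (ha : S a = 0) (hpos : ∀ s, 0 < s → S' s = S (a - 1 / s))
    (hψ' : ∀ s, 0 < s → ψ' s = -ξ * s) : IsGPDTail S' (-ξ) ψ' := by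
  intro ε hε
  refine ((h ε hε).inv_endpoint_sub hS ha hpos).mono fun s hSs ⟨hs, hp⟩ y hy => ?_
  have hξ0 : ξ ≠ 0 := hξ.ne
  have hsy : 0 < s + y := by linarith
  have hw : 0 ≤ y / (-ξ * s) := div_nonneg hy (by nlinarith)
  rw [hψ' s hs]
  have e0 : 1 - ξ * (y / (-ξ * s)) = (s + y) / s := by field_simp; ring
  have h1 := hp (1 / s - 1 / (s + y)) (by
    have : 1 / s - 1 / (s + y) = y / (s * (s + y)) := by field_simp; ring
    rw [this]
    positivity)
  have e1 : (1 / s - 1 / (s + y)) / (-ξ * (a - (a - 1 / s))) =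
      y / (-ξ * s) / (1 - ξ * (y / (-ξ * s))) := by
    rw [e0, sub_sub_cancel]; field_simp; ring
  rw [e1, gpdSurvival_div_one_sub hξ0 hw (by rw [e0]; positivity), sub_add_sub_cancel,
    ← hpos s hs, ← hpos _ hsy] at h1
  exact h1

end Transform

/-! ### Reciprocals of random variables and the main result -/

section Reciprocal

variable {Ω : Type*} [MeasurableSpace Ω] (P : Measure Ω) {X : Ω → ℝ}

theorem survival_neg_inv_of_neg (hX0 : ∀ᵐ ω ∂P, 0 < X ω) {s : ℝ} (hs : s < 0) :
    survival P (fun ω => -1 / X ω) s = survival P X (-1 / s) := by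
  refine measureReal_congr ?_
  filter_upwards [hX0] with ω hω
  refine propext ?_
  change s < -1 / X ω ↔ -1 / s < X ω
  rw [lt_div_iff₀ hω, div_lt_iff_of_neg hs, mul_comm]

theorem survival_neg_inv_of_nonneg (hX0 : ∀ᵐ ω ∂P, 0 < X ω) {s : ℝ} (hs : 0 ≤ s) :
    survival P (fun ω => -1 / X ω) s = 0 := by
  have : P {ω | s < -1 / X ω} = 0 := by
    refine measure_eq_zero_iff_ae_notMem.2 ?_
    filter_upwards [hX0] with ω hω
    have : -1 / X ω < 0 := div_neg_of_neg_of_pos (by norm_num) hω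
    linarith
  rw [survival, measureReal_def, this, ENNReal.toReal_zero]

theorem survival_neg_inv_sub {a : ℝ} (hXa : ∀ᵐ ω ∂P, X ω < a) {s : ℝ} (hs : 0 < s) :
    survival P (fun ω => -1 / (X ω - a)) s = survival P X (a - 1 / s) := by
  refine measureReal_congr ?_
  filter_upwards [hXa] with ω hω
  refine propext ?_
  change s < -1 / (X ω - a) ↔ a - 1 / s < X ω
  have h1 : 0 < a - X ω := by linarith
  rw [show -1 / (X ω - a) = 1 / (a - X ω) by rw [← neg_sub a, div_neg, neg_div, neg_neg],
    lt_one_div hs h1]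
  constructor <;> intro h <;> linarith

variable [IsProbabilityMeasure P]

theorem exists_isLeast_survival_eq_zero (hX : Measurable X) (h : ∃ t, survival P X t = 0) :
    ∃ a, survival P X a = 0 ∧ ∀ t < a, 0 < survival P X t := by
  obtain ⟨t₀, ht₀⟩ := exists_survival_pos P hX
  have hbdd : BddBelow {t | survival P X t = 0} :=
    ⟨t₀, fun t ht => ((antitone_survival P X).reflect_lt (by rwa [show _ = _ from ht])).le⟩
  refine ⟨sInf {t | survival P X t = 0}, ?_, fun t ht => ?_⟩
  · by_contra hne
    obtain ⟨x, hx, hSx⟩ := exists_gt_survival_pos P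
      (lt_of_le_of_ne (survival_nonneg P X _) (Ne.symm hne))
    exact absurd hx (not_lt.2 (le_csInf h fun t ht =>
      ((antitone_survival P X).reflect_lt (by rwa [show _ = _ from ht])).le))
  · refine lt_of_le_of_ne (survival_nonneg P X t) fun h0 => ?_
    exact absurd (csInf_le hbdd h0.symm) (not_le.2 ht)

theorem residualLimitGPD_neg_inv (hX : Measurable X) {ξ : ℝ} (h : ResidualLimitGPD P X ξ)
    (hξ : 0 ≤ ξ) (hX0 : ∀ᵐ ω ∂P, 0 < X ω) : ResidualLimitGPD P (fun ω => -1 / X ω) (-ξ) := by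
  obtain ⟨ψ, hψ, hG⟩ := (residualLimitGPD_iff P hX ξ).1 h
  have hS := antitone_survival P X
  obtain ⟨T, hT, hST⟩ : ∃ T, 0 < T ∧ 0 < survival P X T := by
    refine exists_gt_survival_pos P ?_
    have : P {ω | 0 < X ω} = 1 := (prob_compl_eq_zero_iff (measurableSet_lt measurable_const hX)).1
      (by simpa [compl_def, ae_iff] using hX0)
    simp [survival, measureReal_def, this]
  rw [residualLimitGPD_iff P (hX.const_div (-1))]
  have hasym := fun ε (hε : 0 < ε) =>
    hG.eventually_abs_scale_sub_le hS (survival_nonneg P X) hψ hξ hT hST hε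
  have hneg := fun s (hs : s < 0) => survival_neg_inv_of_neg P hX0 hs
  have hnonneg := fun s (hs : 0 ≤ s) => survival_neg_inv_of_nonneg P hX0 hs
  rcases hξ.eq_or_lt with rfl | hξ
  · refine ⟨fun s => if s < 0 then s ^ 2 * ψ (-1 / s) else 1, fun s => ?_, ?_⟩
    · dsimp only
      split_ifs with hs
      · exact mul_pos (sq_pos_of_neg hs) (hψ _)
      · exact one_pos
    · rw [neg_zero]
      refine hG.neg_inv_of_shape_zero hψ (fun ε hε => (hasym ε hε).mono fun t _ ht => ?_) hT hST
        hneg hnonneg fun s hs => if_pos hs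
      rw [zero_mul, sub_zero] at ht
      exact (le_abs_self _).trans ht
  · refine ⟨fun s => if s < 0 then -ξ * s else 1, fun s => ?_, ?_⟩
    · dsimp only
      split_ifs with hs
      · nlinarith
      · exact one_pos
    · refine (hG.congr_scale (φ := fun t => ξ * t) hψ fun η hη => ?_).neg_inv_of_shape_pos hξ hT hST
        hneg hnonneg fun s hs => if_pos hs
      -- This tolerance yields ψ(t) ≥ ξt/(1+η), so the error relative to t becomes at most ηψ(t).
      refine (hasym (η * ξ / (1 + η)) (by positivity)).mono fun t _ ht => ?_
      rw [abs_sub_comm]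
      refine ht.trans ?_
      have h1 := (abs_le.1 ht).1
      have e1 : ξ - η * ξ / (1 + η) = ξ / (1 + η) := by field_simp; ring
      have h2 : ξ / (1 + η) * t ≤ ψ t := by rw [← e1]; linarith
      calc η * ξ / (1 + η) * t = η * (ξ / (1 + η) * t) := by ring
        _ ≤ η * ψ t := by gcongr

theorem exists_residualLimitGPD_neg_inv_sub (hX : Measurable X) {ξ : ℝ}
    (h : ResidualLimitGPD P X ξ) (hξ : ξ < 0) :
    ∃ a : ℝ, rightEndpoint P X = (a : EReal) ∧
      ResidualLimitGPD P (fun ω => -1 / (X ω - a)) (-ξ) := by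
  obtain ⟨ψ, hψ, hG⟩ := (residualLimitGPD_iff P hX ξ).1 h
  have hS := antitone_survival P X
  have hS0 := survival_nonneg P X
  obtain ⟨a, ha, hpos⟩ := exists_isLeast_survival_eq_zero P hX <| by
    obtain ⟨T, hT, hz⟩ := hG.eventually_eq_zero_of_shape_neg hS hS0 hψ hξ one_pos
    exact ⟨_, hz T le_rfl hT⟩
  -- Arbitrarily small positive values of S below a exclude an atom at a, where -1/0 = 0 would break
  -- the correspondence of tails.
  have hXa : ∀ᵐ ω ∂P, X ω < a := by
    have h0 : P.real {ω | a ≤ X ω} = 0 := by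
      refine le_antisymm (le_of_forall_pos_le_add fun δ hδ => ?_) measureReal_nonneg
      obtain ⟨t, ht, htδ⟩ := hG.exists_small hψ hδ
      have hta : t < a := hS.reflect_lt (by rwa [ha])
      have : P.real {ω | a ≤ X ω} ≤ survival P X t :=
        measureReal_mono fun ω hω => hta.trans_le hω
      linarith
    rw [measureReal_eq_zero_iff] at h0
    simpa [ae_iff] using h0
  refine ⟨a, rightEndpoint_eq_coe P hX ha hpos, ?_⟩
  rw [residualLimitGPD_iff P ((hX.sub_const a).const_div (-1))]
  refine ⟨fun s => if 0 < s then -ξ * s else 1, fun s => ?_, ?_⟩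
  · dsimp only
    split_ifs with hs
    · nlinarith
    · exact one_pos
  · exact (hG.congr_scale hψ fun η hη =>
      hG.eventually_abs_endpoint_sub_le hS hS0 hψ hξ ha hpos hη).inv_endpoint_sub hS hξ ha
      (fun s hs => survival_neg_inv_sub P hXa hs) fun s hs => if_pos hs

end Reciprocal

theorem corollary2 {Ω : Type*} [MeasurableSpace Ω] (P : Measure Ω) [IsProbabilityMeasure P]
    (X : Ω → ℝ) (hX : Measurable X) (ξ : ℝ) (h : ResidualLimitGPD P X ξ) :
    (0 ≤ ξ → (∀ᵐ ω ∂P, 0 < X ω) → ResidualLimitGPD P (fun ω => -1 / X ω) (-ξ)) ∧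
    (ξ < 0 → ∃ a : ℝ, rightEndpoint P X = (a : EReal) ∧
      ResidualLimitGPD P (fun ω => -1 / (X ω - a)) (-ξ)) :=
  ⟨residualLimitGPD_neg_inv P hX h, exists_residualLimitGPD_neg_inv_sub P hX h⟩
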